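/- Let $p$ be a prime and let $\mathfrak m$ be a Haar measure on the additive group $\mathbb{Q}_p$ of $p$-adic numbers, with dual group $\widehat{\mathbb{Q}}_p$. Let $\Omega\subset\mathbb{Q}_p$ be a Borel set with $0<\mathfrak m(\Omega)<\infty$. Call $\Omega$ a spectral set if there is a set $\Lambda\subset\widehat{\mathbb{Q}}_p$ of continuous characters such that the normalized characters $\mathfrak m(\Omega)^{-1/2}\chi$, $\chi\in\Lambda$, restricted to $\Omega$, form an orthonormal basis of the Hilbert space $L^2(\Omega,\mathfrak m)$. Call $\Omega$ a tile if there is a set $T\subset\mathbb{Q}_p$ such that $\sum_{t\in T}1_\Omega(x-t)=1$ for $\mathfrak m$-almost every $x\in\mathbb{Q}_p$. **Theorem 5.1.** If $\Omega$ is a spectral set in $\mathbb{Q}_p$, then $\Omega$ is a tile. -/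

import Mathlib

open MeasureTheory
open scoped ENNReal

section Fuglede

variable {G : Type*} [AddCommGroup G] [TopologicalSpace G] [MeasurableSpace G]

/-- The character `χ` of the additive group `G`, divided by its norm `μ(Ω)^(1/2)` in `L²(Ω)`.
Mathlib's Pontryagin dual is written for multiplicative groups, so the dual group of `G` is
`PontryaginDual (Multiplicative G)`. -/
noncomputable def normalizedCharacter (μ : Measure G) (Ω : Set G)
    (χ : PontryaginDual (Multiplicative G)) : G → ℂ :=
  fun x => ((Real.sqrt (μ.real Ω) : ℝ) : ℂ)⁻¹ * (χ (Multiplicative.ofAdd x) : ℂ)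

/-- `(Ω, Λ)` is a spectral pair: the characters in `Λ`, normalized in `L²(Ω)`, are an
orthonormal (Hilbert) basis of `L²(Ω)`. -/
def IsSpectralPair (μ : Measure G) (Ω : Set G)
    (Λ : Set (PontryaginDual (Multiplicative G))) : Prop :=
  ∃ b : HilbertBasis Λ ℂ (Lp ℂ 2 (μ.restrict Ω)),
    ∀ χ : Λ, (b χ : G → ℂ) =ᵐ[μ.restrict Ω] normalizedCharacter μ Ω χ

/-- `Ω` is a spectral set: it has a spectrum. -/
def IsSpectralSet (μ : Measure G) (Ω : Set G) : Prop :=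
  ∃ Λ : Set (PontryaginDual (Multiplicative G)), IsSpectralPair μ Ω Λ

/-- `(Ω, T)` is a tiling pair: `∑_{t ∈ T} 1_Ω(x - t) = 1` for almost every `x`. The sum is taken
in `[0, ∞]`, where it always converges. -/
def IsTilingPair (μ : Measure G) (Ω T : Set G) : Prop :=
  ∀ᵐ x ∂μ, ∑' t : T, Ω.indicator (fun _ => (1 : ℝ≥0∞)) (x - t) = 1

/-- `Ω` is a tile: it has a tiling complement. -/
def IsTile (μ : Measure G) (Ω : Set G) : Prop :=
  ∃ T : Set G, IsTilingPair μ Ω T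

end Fuglede

/-! Let `D` be the set of density points of `Ω`, which is almost all of `Ω`, and let `I` be the set
of valuations of differences of points of `D`. Both the measure of `Ω` and the size of its spectrum
`Λ` are controlled by counting the elements of `I` below `n`; write `J n` for these.

Upper bound: points of `D` in different cosets of `p ^ n ℤ_p` are separated by a digit at a level in
`J n`, so `D` meets at most `p ^ #(J n)` such cosets (`exists_centers`).

Lower bound: let `x`, `y` in `D` differ by valuation `j`. Parseval for the disjoint pieces of `Ω` in
small balls around them is a vanishing sum over `Λ`. Grouped by restriction to the small ball, its
diagonal term dominates the others, which forces the values at `x - y` to sum to zero on each class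
(`exists_finset_sum_charVal_eq_zero`). These values are, up to a common factor, roots of unity of
`p`-power order, so they are stable under `p`-th roots of unity (`exists_eq_mul_of_sum_eq_zero`),
and `Λ` branches at `j`. Hence `p ^ #(J n)` elements of `Λ` agree on `p ^ n ℤ_p`, and Parseval on
one ball limits their number (`card_mul_measureReal_le`).

At a density point the two bounds agree in the limit. Since `p ^ #(J n) μ(p ^ n ℤ_p)` changes only
by factors `1` or `1 / p`, it equals `μ(Ω)` at some `n`. Then `Ω` is almost everywhere a union of `p
^ #(J n)` balls realizing every digit pattern at the levels in `J n`, and such a union is tiled by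
points whose digits at these levels vanish. -/

/-! ### Characters as complex-valued functions. -/

section Characters

variable {G : Type*} [AddCommGroup G] [TopologicalSpace G]

/-- The complex value of a character of the additive group `G`. -/
noncomputable def charVal (χ : PontryaginDual (Multiplicative G)) (x : G) : ℂ :=
  (χ (Multiplicative.ofAdd x) : ℂ)

@[simp]
lemma norm_charVal (χ : PontryaginDual (Multiplicative G)) (x : G) : ‖charVal χ x‖ = 1 :=
  Circle.norm_coe _

lemma charVal_ne_zero (χ : PontryaginDual (Multiplicative G)) (x : G) : charVal χ x ≠ 0 :=
  Circle.coe_ne_zero _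

lemma continuous_charVal (χ : PontryaginDual (Multiplicative G)) : Continuous (charVal χ) :=
  continuous_subtype_val.comp ((map_continuous χ).comp continuous_ofAdd)

lemma charVal_add (χ : PontryaginDual (Multiplicative G)) (x y : G) :
    charVal χ (x + y) = charVal χ x * charVal χ y := by
  simp [charVal]

lemma charVal_nsmul (χ : PontryaginDual (Multiplicative G)) (n : ℕ) (x : G) :
    charVal χ (n • x) = charVal χ x ^ n := by
  simp [charVal]

lemma charVal_neg (χ : PontryaginDual (Multiplicative G)) (x : G) :
    charVal χ (-x) = starRingEnd ℂ (charVal χ x) := by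
  rw [charVal, ofAdd_neg, map_inv, Circle.coe_inv_eq_conj, charVal]

lemma charVal_sub (χ : PontryaginDual (Multiplicative G)) (x y : G) :
    charVal χ (x - y) = charVal χ x * starRingEnd ℂ (charVal χ y) := by
  rw [sub_eq_add_neg, charVal_add, charVal_neg]

lemma charVal_div (χ ψ : PontryaginDual (Multiplicative G)) (x : G) :
    charVal (χ / ψ) x = charVal χ x * starRingEnd ℂ (charVal ψ x) := by
  have : (χ / ψ) (Multiplicative.ofAdd x)
      = χ (Multiplicative.ofAdd x) / ψ (Multiplicative.ofAdd x) := rfl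
  rw [charVal, this, div_eq_mul_inv, Circle.coe_mul, Circle.coe_inv_eq_conj, charVal, charVal]

lemma charVal_mul_conj (χ : PontryaginDual (Multiplicative G)) (x : G) :
    charVal χ x * starRingEnd ℂ (charVal χ x) = 1 := by
  rw [Complex.mul_conj, Complex.normSq_eq_norm_sq]; simp

@[simp]
lemma charVal_one (x : G) : charVal (1 : PontryaginDual (Multiplicative G)) x = 1 := by
  simp [charVal]

/-- The set `a + K`. -/
def addCoset (K : AddSubgroup G) (a : G) : Set G := {x | x - a ∈ K}

/-- Two characters agree on the subgroup `K`. -/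
def AgreeOn (K : AddSubgroup G) (χ ψ : PontryaginDual (Multiplicative G)) : Prop :=
  ∀ w ∈ K, charVal χ w = charVal ψ w

lemma AgreeOn.symm {K : AddSubgroup G} {χ ψ : PontryaginDual (Multiplicative G)}
    (h : AgreeOn K χ ψ) : AgreeOn K ψ χ := fun w hw => (h w hw).symm

lemma AgreeOn.trans {K : AddSubgroup G} {χ ψ φ : PontryaginDual (Multiplicative G)}
    (h : AgreeOn K χ ψ) (h' : AgreeOn K ψ φ) : AgreeOn K χ φ :=
  fun w hw => (h w hw).trans (h' w hw)

lemma AgreeOn.mono {K H : AddSubgroup G} (hKH : K ≤ H)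
    {χ ψ : PontryaginDual (Multiplicative G)} (h : AgreeOn H χ ψ) : AgreeOn K χ ψ :=
  fun w hw => h w (hKH hw)

lemma AgreeOn.div {K : AddSubgroup G} {χ ψ : PontryaginDual (Multiplicative G)}
    (h : AgreeOn K χ ψ) (ξ : PontryaginDual (Multiplicative G)) :
    AgreeOn K (χ / ξ) (ψ / ξ) := fun w hw => by rw [charVal_div, charVal_div, h w hw]

/-- Agreement on `K` as an equivalence relation on the dual group. -/
def agreeSetoid (K : AddSubgroup G) : Setoid (PontryaginDual (Multiplicative G)) where
  r := AgreeOn K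
  iseqv := ⟨fun _ _ _ => rfl, AgreeOn.symm, AgreeOn.trans⟩

end Characters

/-! ### Fourier transforms of sets contained in one coset. -/

section CharacterIntegrals

variable {G : Type*} [AddCommGroup G] [TopologicalSpace G] [MeasurableSpace G] {μ : Measure G}

/-- The Fourier transform of the indicator of `E`. -/
noncomputable def charInt (μ : Measure G) (E : Set G)
    (χ : PontryaginDual (Multiplicative G)) : ℂ := ∫ x in E, charVal χ x ∂μ

/-- On `a + K` the two characters are proportional, with the ratio of their values at `a` as
constant. -/
lemma charInt_of_agreeOn {K : AddSubgroup G} {a : G} {E : Set G} (hE : MeasurableSet E)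
    (hEK : E ⊆ addCoset K a) {χ ψ : PontryaginDual (Multiplicative G)} (h : AgreeOn K χ ψ) :
    charInt μ E χ = charVal χ a * starRingEnd ℂ (charVal ψ a) * charInt μ E ψ := by
  rw [charInt, charInt, ← integral_const_mul]
  refine setIntegral_congr_fun hE fun x hx => ?_
  have h1 := h (x - a) (hEK hx)
  have h2 : charVal χ x = charVal χ (x - a) * charVal χ a := by rw [← charVal_add]; simp
  rw [charVal_sub ψ] at h1
  rw [h2, h1]; ring

lemma charInt_of_agreeOn_one {K : AddSubgroup G} {a : G} {E : Set G} (hE : MeasurableSet E)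
    (hEK : E ⊆ addCoset K a) {χ ψ : PontryaginDual (Multiplicative G)} (h : AgreeOn K χ ψ) :
    ‖charInt μ E (χ / ψ)‖ = μ.real E := by
  have h1 : AgreeOn K (χ / ψ) (ψ / ψ) := h.div ψ
  rw [charInt_of_agreeOn hE hEK h1, norm_mul, norm_mul, RCLike.norm_conj, norm_charVal,
    norm_charVal, charInt]
  simp

end CharacterIntegrals

/-! ### Parseval and counting in a spectrum. -/

section SpectralPairs

variable {G : Type*} [AddCommGroup G] [TopologicalSpace G] [MeasurableSpace G] [BorelSpace G]
  {μ : Measure G}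

lemma memLp_charVal (ν : Measure G) [IsFiniteMeasure ν]
    (χ : PontryaginDual (Multiplicative G)) : MemLp (charVal χ) 2 ν :=
  MemLp.of_bound (continuous_charVal χ).aestronglyMeasurable 1
    (Filter.Eventually.of_forall fun x => (norm_charVal χ x).le)

/-- The modulated indicator `ξ 1_A` as an element of `L²(Ω)`. -/
lemma memLp_indicator_charVal {Ω A : Set G} (hA : MeasurableSet A) (hfin : μ Ω ≠ ∞)
    (ξ : PontryaginDual (Multiplicative G)) :
    MemLp (A.indicator (charVal ξ)) 2 (μ.restrict Ω) := by
  have : IsFiniteMeasure (μ.restrict Ω) := ⟨by simpa using hfin.lt_top⟩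
  exact (memLp_charVal _ ξ).indicator hA

/-- Modulating by `ξ` translates the spectrum, so any class can be moved to that of the trivial
character. -/
lemma inner_modulated_indicator {Ω : Set G} (hfin : μ Ω ≠ ∞)
    {χ ξ : PontryaginDual (Multiplicative G)} {g : Lp ℂ 2 (μ.restrict Ω)}
    (hg : (g : G → ℂ) =ᵐ[μ.restrict Ω] normalizedCharacter μ Ω χ)
    {E : Set G} (hE : MeasurableSet E) (hEΩ : E ⊆ Ω) :
    inner ℂ ((memLp_indicator_charVal (μ := μ) hE hfin ξ).toLp) g
      = ((Real.sqrt (μ.real Ω) : ℝ) : ℂ)⁻¹ * charInt μ E (χ / ξ) := by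
  rw [L2.inner_def, charInt, ← integral_const_mul]
  have hΩE : E = Ω ∩ E := (Set.inter_eq_right.2 hEΩ).symm
  conv_rhs => rw [hΩE]
  rw [← setIntegral_indicator hE]
  refine integral_congr_ae ?_
  filter_upwards [hg, (memLp_indicator_charVal (μ := μ) hE hfin ξ).coeFn_toLp] with x h1 h2
  rw [h1, h2, RCLike.inner_apply]
  by_cases hx : x ∈ E
  · simp only [Set.indicator_of_mem hx, charVal_div, normalizedCharacter]
    rw [mul_assoc]; rfl
  · simp [Set.indicator_of_notMem hx]

/-- **Parseval identity** for a spectral pair, applied to modulated indicators. -/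
lemma hasSum_charInt_mul_conj {Ω : Set G} (hpos : μ Ω ≠ 0) (hfin : μ Ω ≠ ∞)
    {Λ : Set (PontryaginDual (Multiplicative G))} (hΛ : IsSpectralPair μ Ω Λ)
    {A B : Set G} (hA : MeasurableSet A) (hB : MeasurableSet B) (hAΩ : A ⊆ Ω) (hBΩ : B ⊆ Ω)
    (ξ : PontryaginDual (Multiplicative G)) :
    HasSum (fun χ : Λ => charInt μ A (χ / ξ) * starRingEnd ℂ (charInt μ B (χ / ξ)))
      ((μ.real Ω * μ.real (A ∩ B) : ℝ) : ℂ) := by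
  obtain ⟨b, hb⟩ := hΛ
  have hm : 0 < μ.real Ω := ENNReal.toReal_pos hpos hfin
  have h := b.hasSum_inner_mul_inner ((memLp_indicator_charVal (μ := μ) hA hfin ξ).toLp)
    ((memLp_indicator_charVal (μ := μ) hB hfin ξ).toLp)
  have hAB : inner ℂ ((memLp_indicator_charVal (μ := μ) hA hfin ξ).toLp)
      ((memLp_indicator_charVal (μ := μ) hB hfin ξ).toLp) = ((μ.real (A ∩ B) : ℝ) : ℂ) := by
    rw [L2.inner_def]
    have : ∀ᵐ x ∂(μ.restrict Ω), inner ℂ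
        (((memLp_indicator_charVal (μ := μ) hA hfin ξ).toLp : Lp ℂ 2 (μ.restrict Ω)) x)
        (((memLp_indicator_charVal (μ := μ) hB hfin ξ).toLp : Lp ℂ 2 (μ.restrict Ω)) x)
        = (A ∩ B).indicator (fun _ => (1 : ℂ)) x := by
      filter_upwards [(memLp_indicator_charVal (μ := μ) hA hfin ξ).coeFn_toLp,
        (memLp_indicator_charVal (μ := μ) hB hfin ξ).coeFn_toLp] with x h1 h2
      rw [h1, h2, RCLike.inner_apply]
      by_cases hxA : x ∈ A <;> by_cases hxB : x ∈ B <;> simp [hxA, hxB, charVal_mul_conj]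
    rw [integral_congr_ae this, setIntegral_indicator (hA.inter hB),
      Set.inter_eq_right.2 (Set.inter_subset_left.trans hAΩ)]
    simp
  rw [hAB] at h
  have h' := h.mul_left ((μ.real Ω : ℝ) : ℂ)
  push_cast
  refine h'.congr_fun fun χ => ?_
  rw [← inner_conj_symm (b χ), inner_modulated_indicator hfin (hb χ) hA hAΩ,
    inner_modulated_indicator hfin (hb χ) hB hBΩ]
  have hs : ((Real.sqrt (μ.real Ω) : ℝ) : ℂ) * ((Real.sqrt (μ.real Ω) : ℝ) : ℂ)
      = ((μ.real Ω : ℝ) : ℂ) := by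
    rw [← Complex.ofReal_mul, Real.mul_self_sqrt hm.le]
  have hs0 : ((Real.sqrt (μ.real Ω) : ℝ) : ℂ) ≠ 0 := by
    simpa using (Real.sqrt_pos.2 hm).ne'
  rw [map_mul, map_inv₀, Complex.conj_ofReal, ← hs]
  field_simp

/-- The number of elements of a spectrum which agree on `K` is controlled by the measure of the
part of `Ω` in any coset of `K`. -/
lemma card_mul_measureReal_le {Ω : Set G} (hΩ : MeasurableSet Ω) (hpos : μ Ω ≠ 0)
    (hfin : μ Ω ≠ ∞) {Λ : Set (PontryaginDual (Multiplicative G))} (hΛ : IsSpectralPair μ Ω Λ)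
    {K : AddSubgroup G} {a : G} (hK : MeasurableSet (addCoset K a))
    (ξ : PontryaginDual (Multiplicative G)) (F : Finset Λ) (hF : ∀ χ ∈ F, AgreeOn K χ.1 ξ) :
    F.card * μ.real (Ω ∩ addCoset K a) ≤ μ.real Ω := by
  set A := Ω ∩ addCoset K a with hA
  have hAm : MeasurableSet A := hΩ.inter hK
  have h := hasSum_charInt_mul_conj hpos hfin hΛ hAm hAm Set.inter_subset_left
    Set.inter_subset_left ξ
  simp only [Complex.mul_conj, Set.inter_self] at h
  have h' := Complex.hasSum_ofReal.1 h
  rcases (measureReal_nonneg (μ := μ) (s := A)).eq_or_lt with h0 | h0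
  · rw [← h0]; simp
  have h1 := sum_le_hasSum F (fun χ _ => Complex.normSq_nonneg _) h'
  have h2 : ∑ χ ∈ F, Complex.normSq (charInt μ A (χ / ξ)) = F.card * μ.real A ^ 2 := by
    rw [← nsmul_eq_mul, ← Finset.sum_const]
    refine Finset.sum_congr rfl fun χ hχ => ?_
    rw [Complex.normSq_eq_norm_sq, charInt_of_agreeOn_one hAm Set.inter_subset_right (hF χ hχ)]
  rw [h2] at h1
  nlinarith

lemma finite_agreeOn {Ω : Set G} (hΩ : MeasurableSet Ω) (hfin : μ Ω ≠ ∞)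
    {Λ : Set (PontryaginDual (Multiplicative G))} (hΛ : IsSpectralPair μ Ω Λ)
    {K : AddSubgroup G}
    {a : G} (hK : MeasurableSet (addCoset K a)) (ha : 0 < μ.real (Ω ∩ addCoset K a))
    (ξ : PontryaginDual (Multiplicative G)) : {χ : Λ | AgreeOn K χ.1 ξ}.Finite := by
  have hpos : μ Ω ≠ 0 := fun h => by
    have := measureReal_mono (μ := μ) (Set.inter_subset_left (s := Ω) (t := addCoset K a)) hfin
    rw [measureReal_def μ Ω, h] at this
    simp at this; linarith
  by_contra hinf
  obtain ⟨n, hn⟩ := exists_nat_gt (μ.real Ω / μ.real (Ω ∩ addCoset K a))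
  obtain ⟨F, hF, hFn⟩ := Set.Infinite.exists_subset_card_eq hinf n
  have := card_mul_measureReal_le hΩ hpos hfin hΛ hK ξ F
    fun χ hχ => hF hχ
  rw [hFn, ← le_div_iff₀ ha] at this
  linarith

end SpectralPairs

/-! ### Orthogonality of characters on a coset of an open subgroup. -/

section Bessel

variable {G : Type*} [AddCommGroup G] [TopologicalSpace G] [IsTopologicalAddGroup G]
  [MeasurableSpace G] [BorelSpace G] {μ : Measure G} [μ.IsAddLeftInvariant]

lemma measurableSet_addCoset {K : AddSubgroup G} (hK : IsOpen (K : Set G)) (a : G) :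
    MeasurableSet (addCoset K a) :=
  (hK.preimage (continuous_id.sub continuous_const)).measurableSet

lemma measure_addCoset (K : AddSubgroup G) (a : G) : μ (addCoset K a) = μ K := by
  have : addCoset K a = (fun x => -a + x) ⁻¹' (K : Set G) := by
    ext x; simp [addCoset, sub_eq_neg_add]
  rw [this, measure_preimage_add]

/-- Translation by `w` preserves the coset and multiplies the integral by `χ(w) ≠ 1`. -/
lemma charInt_addCoset_eq_zero {K : AddSubgroup G} (hK : IsOpen (K : Set G)) (a : G)
    {χ : PontryaginDual (Multiplicative G)} (hχ : ∃ w ∈ K, charVal χ w ≠ 1) :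
    charInt μ (addCoset K a) χ = 0 := by
  obtain ⟨w, hw, hw1⟩ := hχ
  have h : charInt μ (addCoset K a) χ = charVal χ w * charInt μ (addCoset K a) χ := by
    have hm := measurableSet_addCoset hK a
    rw [charInt, ← integral_indicator hm, ← integral_const_mul,
      ← integral_add_left_eq_self _ w]
    refine integral_congr_ae (Filter.Eventually.of_forall fun x => ?_)
    have hiff : w + x ∈ addCoset K a ↔ x ∈ addCoset K a := by
      simp only [addCoset, Set.mem_ofPred_eq, add_sub_assoc]
      exact K.add_mem_cancel_left hw
    by_cases hx : x ∈ addCoset K a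
    · simp [Set.indicator_of_mem (hiff.2 hx), Set.indicator_of_mem hx, charVal_add]
    · simp [Set.indicator_of_notMem (mt hiff.1 hx), Set.indicator_of_notMem hx]
  have h' : (charVal χ w - 1) * charInt μ (addCoset K a) χ = 0 := by
    linear_combination -h
  exact (mul_eq_zero.1 h').resolve_left (sub_ne_zero.2 hw1)

/-- **Bessel inequality** on a coset of `K`. -/
lemma sum_norm_charInt_sq_le {K : AddSubgroup G} (hK : IsOpen (K : Set G)) (hK0 : μ K ≠ 0)
    (hKfin : μ K ≠ ∞) (a : G) {E : Set G} (hE : MeasurableSet E) (hEK : E ⊆ addCoset K a)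
    {ι : Type*} (χ : ι → PontryaginDual (Multiplicative G))
    (hχ : Pairwise fun i j => ¬ AgreeOn K (χ i) (χ j)) (F : Finset ι) :
    ∑ i ∈ F, ‖charInt μ E (χ i)‖ ^ 2 ≤ μ.real K * μ.real E := by
  classical
  set C := addCoset K a
  have hC : μ C = μ K := measure_addCoset K a
  have : IsFiniteMeasure (μ.restrict C) := ⟨by simpa [hC] using hKfin.lt_top⟩
  have hm : 0 < μ.real K := ENNReal.toReal_pos hK0 hKfin
  have hs0 : ((Real.sqrt (μ.real K) : ℝ) : ℂ) ≠ 0 := by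
    simpa using (Real.sqrt_pos.2 hm).ne'
  have hs : ((Real.sqrt (μ.real K) : ℝ) : ℂ) * ((Real.sqrt (μ.real K) : ℝ) : ℂ)
      = ((μ.real K : ℝ) : ℂ) := by
    rw [← Complex.ofReal_mul, Real.mul_self_sqrt hm.le]
  set c : ℂ := ((Real.sqrt (μ.real K) : ℝ) : ℂ)⁻¹ with hc
  let v : ι → Lp ℂ 2 (μ.restrict C) := fun i => c • (memLp_charVal (μ.restrict C) (χ i)).toLp
  have hinner : ∀ i j, inner ℂ ((memLp_charVal (μ.restrict C) (χ i)).toLp)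
      ((memLp_charVal (μ.restrict C) (χ j)).toLp) = charInt μ C (χ j / χ i) := by
    intro i j
    rw [L2.inner_def, charInt]
    refine integral_congr_ae ?_
    filter_upwards [(memLp_charVal (μ.restrict C) (χ i)).coeFn_toLp,
      (memLp_charVal (μ.restrict C) (χ j)).coeFn_toLp] with x h1 h2
    rw [h1, h2, RCLike.inner_apply, charVal_div]
  have hv : Orthonormal ℂ v := by
    rw [orthonormal_iff_ite]
    intro i j
    simp only [v, inner_smul_left, inner_smul_right, hinner]
    split_ifs with hij
    · subst hij
      have : charInt μ C (χ i / χ i) = ((μ.real K : ℝ) : ℂ) := by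
        simp [charInt, measureReal_def, hC]
      rw [this, ← hs, hc, map_inv₀, Complex.conj_ofReal]
      field_simp
    · rw [charInt_addCoset_eq_zero hK, mul_zero, mul_zero]
      by_contra! hcon
      refine hχ hij fun w hw => ?_
      have h1 := hcon w hw
      rw [charVal_div] at h1
      have h2 := charVal_mul_conj (χ i) w
      have h3 : charVal (χ j) w * (charVal (χ i) w * starRingEnd ℂ (charVal (χ i) w))
          = charVal (χ i) w := by linear_combination (charVal (χ i) w) * h1
      rw [h2, mul_one] at h3
      exact h3.symm
  have hone : MemLp (E.indicator fun _ => (1 : ℂ)) 2 (μ.restrict C) :=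
    (memLp_const 1).indicator hE
  have hb := hv.sum_inner_products_le (x := hone.toLp) (s := F)
  have hEC : C ∩ E = E := Set.inter_eq_right.2 hEK
  have hl : ∀ i, ‖inner ℂ (v i) hone.toLp‖ ^ 2 = (μ.real K)⁻¹ * ‖charInt μ E (χ i)‖ ^ 2 := by
    intro i
    have : inner ℂ hone.toLp ((memLp_charVal (μ.restrict C) (χ i)).toLp)
        = charInt μ E (χ i) := by
      rw [L2.inner_def, charInt]
      conv_rhs => rw [← hEC]
      rw [← setIntegral_indicator hE]
      refine integral_congr_ae ?_
      filter_upwards [(memLp_charVal (μ.restrict C) (χ i)).coeFn_toLp,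
        hone.coeFn_toLp] with x h1 h2
      rw [h1, h2, RCLike.inner_apply]
      by_cases hx : x ∈ E <;> simp [hx]
    simp only [v, inner_smul_left]
    rw [← inner_conj_symm, this, norm_mul, RCLike.norm_conj, RCLike.norm_conj, mul_pow, hc,
      norm_inv, Complex.norm_real, Real.norm_eq_abs, inv_pow, sq_abs, Real.sq_sqrt hm.le]
  have hr : ‖hone.toLp‖ ^ 2 = μ.real E := by
    have h1 := inner_self_eq_norm_sq_to_K (𝕜 := ℂ) hone.toLp
    rw [L2.inner_def] at h1
    have h2 : ∀ᵐ x ∂(μ.restrict C), inner ℂ ((hone.toLp : Lp ℂ 2 (μ.restrict C)) x)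
        ((hone.toLp : Lp ℂ 2 (μ.restrict C)) x) = E.indicator (fun _ => (1 : ℂ)) x := by
      filter_upwards [hone.coeFn_toLp] with x h1
      rw [h1, RCLike.inner_apply]
      by_cases hx : x ∈ E <;> simp [hx]
    rw [integral_congr_ae h2, setIntegral_indicator hE, hEC] at h1
    simp only [integral_const, measureReal_restrict_apply_univ] at h1
    have h3 : ((μ.real E : ℝ) : ℂ) = ((‖hone.toLp‖ ^ 2 : ℝ) : ℂ) := by simpa using h1
    exact (Complex.ofReal_injective h3).symm
  simp only [hl, ← Finset.mul_sum, hr] at hb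
  rwa [inv_mul_le_iff₀ hm] at hb

end Bessel

/-! ### Vanishing of character sums on the classes of a spectrum. -/

section Vanishing

variable {G : Type*} [AddCommGroup G] [TopologicalSpace G] [IsTopologicalAddGroup G]
  [MeasurableSpace G] [BorelSpace G] {μ : Measure G} [μ.IsAddLeftInvariant]

/-- If a sum of pairwise products against a bounded function is dominated by a single term up to a
factor `θ`, then that term of the function is at most `θ` times the bound. -/
lemma norm_le_of_hasSum_zero {Q : Type*} {s D : Q → ℂ} (h : HasSum (fun q => s q * D q) 0)
    (q₀ : Q) {θ S d : ℝ} (hS : ∀ q, ‖s q‖ ≤ S) (hd : 0 < d) (hD : ‖D q₀‖ = d)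
    (hF : ∀ F : Finset Q, q₀ ∉ F → ∑ q ∈ F, ‖D q‖ ≤ θ * d) : ‖s q₀‖ ≤ θ * S := by
  classical
  have hS0 : 0 ≤ S := (norm_nonneg _).trans (hS q₀)
  have hlim : Filter.Tendsto (fun F : Finset Q => ‖∑ q ∈ F, s q * D q‖) Filter.atTop (nhds 0) := by
    simpa using h.norm
  have hev : ∀ᶠ F : Finset Q in Filter.atTop,
      ‖s q₀‖ * d - S * (θ * d) ≤ ‖∑ q ∈ F, s q * D q‖ := by
    filter_upwards [Filter.eventually_ge_atTop {q₀}] with F hq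
    have hq : q₀ ∈ F := by simpa using hq
    rw [← Finset.add_sum_erase F _ hq]
    have h1 : ‖∑ q ∈ F.erase q₀, s q * D q‖ ≤ S * (θ * d) := by
      refine (norm_sum_le _ _).trans ?_
      refine (Finset.sum_le_sum fun q _ => ?_ :
        _ ≤ ∑ q ∈ F.erase q₀, S * ‖D q‖).trans ?_
      · rw [norm_mul]; gcongr; exact hS q
      · rw [← Finset.mul_sum]; gcongr; exact hF _ (by simp)
    have h2 := norm_sub_le_norm_add (s q₀ * D q₀) (∑ q ∈ F.erase q₀, s q * D q)
    rw [norm_mul, hD] at h2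
    linarith
  have := ge_of_tendsto hlim hev
  nlinarith

/-- If `Ω` fills more than half of two distinct cosets `a + K` and `b + K`, then on each class of
the spectrum modulo the annihilator of `K`, the values at `a - b` have sum zero. -/
theorem exists_finset_sum_charVal_eq_zero {Ω : Set G} (hΩ : MeasurableSet Ω) (hfin : μ Ω ≠ ∞)
    {Λ : Set (PontryaginDual (Multiplicative G))} (hΛ : IsSpectralPair μ Ω Λ)
    {K : AddSubgroup G} (hK : IsOpen (K : Set G)) (hKfin : μ K ≠ ∞) {a b : G} (hab : a - b ∉ K)
    (ha : μ.real K < 2 * μ.real (Ω ∩ addCoset K a))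
    (hb : μ.real K < 2 * μ.real (Ω ∩ addCoset K b))
    (ξ : PontryaginDual (Multiplicative G)) :
    ∃ F : Finset Λ, (∀ χ : Λ, χ ∈ F ↔ AgreeOn K χ.1 ξ) ∧ ∑ χ ∈ F, charVal χ.1 (a - b) = 0 := by
  classical
  have hK0' : 0 ≤ μ.real K := measureReal_nonneg
  have ha0 : 0 < μ.real (Ω ∩ addCoset K a) := by linarith
  have hb0 : 0 < μ.real (Ω ∩ addCoset K b) := by linarith
  have hpos : μ Ω ≠ 0 := fun h => by
    have := measureReal_mono (μ := μ) (Set.inter_subset_left (s := Ω) (t := addCoset K a)) hfin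
    rw [measureReal_def μ Ω, h] at this
    simp at this; linarith
  have hKa : μ.real (Ω ∩ addCoset K a) ≤ μ.real K := by
    rw [measureReal_def μ K, ← measure_addCoset K a]
    exact measureReal_mono Set.inter_subset_right (by rwa [measure_addCoset])
  have hKb : μ.real (Ω ∩ addCoset K b) ≤ μ.real K := by
    rw [measureReal_def μ K, ← measure_addCoset K b]
    exact measureReal_mono Set.inter_subset_right (by rwa [measure_addCoset])
  have hK0 : μ K ≠ 0 := fun h => by
    rw [measureReal_def μ K, h] at hKa; simp at hKa; linarith
  set A := Ω ∩ addCoset K a with hA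
  set B := Ω ∩ addCoset K b with hB
  have hAm : MeasurableSet A := hΩ.inter (measurableSet_addCoset hK a)
  have hBm : MeasurableSet B := hΩ.inter (measurableSet_addCoset hK b)
  have hAB : A ∩ B = ∅ := by
    ext x
    simp only [Set.mem_inter_iff, Set.mem_empty_iff_false, iff_false]
    rintro ⟨⟨-, h1⟩, ⟨-, h2⟩⟩
    apply hab
    have := K.sub_mem h2 h1
    simpa using this
  have hfinite := fun ξ => finite_agreeOn hΩ hfin hΛ (measurableSet_addCoset hK a) ha0 ξ
  let Fs : PontryaginDual (Multiplicative G) → Finset Λ := fun ξ => (hfinite ξ).toFinset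
  have hFs : ∀ ξ (χ : Λ), χ ∈ Fs ξ ↔ AgreeOn K χ.1 ξ := fun ξ χ => by simp [Fs]
  refine ⟨Fs ξ, hFs ξ, ?_⟩
  let Q := Quotient (agreeSetoid (G := G) K)
  let s : Q → ℂ := fun q => ∑ χ ∈ Fs q.out, charVal χ.1 (a - b)
  have hmk : ∀ χ : PontryaginDual (Multiplicative G),
      AgreeOn K (Quotient.out (Quotient.mk (agreeSetoid K) χ)) χ :=
    fun χ => Quotient.mk_out (s := agreeSetoid K) χ
  have hsξ : ∀ ξ, s (Quotient.mk (agreeSetoid K) ξ) = ∑ χ ∈ Fs ξ, charVal χ.1 (a - b) := by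
    intro ξ
    have : Fs (Quotient.out (Quotient.mk (agreeSetoid K) ξ)) = Fs ξ := by
      ext χ; rw [hFs, hFs]
      exact ⟨fun h => h.trans (hmk ξ), fun h => h.trans (hmk ξ).symm⟩
    simp only [s, this]
  -- An a priori bound uniform in the class, without which the contraction below could not start.
  obtain ⟨M, hM⟩ : ∃ M, ∀ q, ‖s q‖ ≤ M := by
    refine ⟨μ.real Ω / μ.real A, fun q => (norm_sum_le _ _).trans ?_⟩
    simp only [norm_charVal, Finset.sum_const, nsmul_eq_mul, mul_one]
    rw [le_div_iff₀ ha0]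
    exact card_mul_measureReal_le hΩ hpos hfin hΛ (measurableSet_addCoset hK a) _ _
      fun χ hχ => (hFs _ χ).1 hχ
  set mA := μ.real A
  set mB := μ.real B
  set mK := μ.real K
  -- Ratio of the Cauchy–Schwarz bound for the off-diagonal terms to the diagonal term `mA * mB`. It
  -- is less than `1` because `mK < mA + mB`; this is where "more than half" enters.
  set θ : ℝ := Real.sqrt (((mK - mA) * (mK - mB)) / (mA * mB)) with hθ
  have hθ1 : θ < 1 := by
    rw [hθ, Real.sqrt_lt' one_pos, div_lt_iff₀ (by positivity)]
    nlinarith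
  have hθ0 : 0 ≤ θ := Real.sqrt_nonneg _
  have step : ∀ S, (∀ q, ‖s q‖ ≤ S) → ∀ q, ‖s q‖ ≤ θ * S := by
    intro S hS q₀
    let ξ := Quotient.out q₀
    let D : Q → ℂ := fun q => starRingEnd ℂ (charVal (Quotient.out q) (a - b)) *
      (charInt μ A (Quotient.out q / ξ) * starRingEnd ℂ (charInt μ B (Quotient.out q / ξ)))
    have hnD : ∀ q, ‖D q‖ = ‖charInt μ A (Quotient.out q / ξ)‖
        * ‖charInt μ B (Quotient.out q / ξ)‖ := fun q => by
      simp only [D, norm_mul, RCLike.norm_conj, norm_charVal, one_mul]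
    -- Disjointness makes the Parseval sum zero. Within a class, only the factor `χ(a - b)` depends
    -- on `χ`, so each fibre sums to `s q * D q`.
    have hsum : HasSum (fun q => s q * D q) 0 := by
      have h := hasSum_charInt_mul_conj hpos hfin hΛ hAm hBm Set.inter_subset_left
        Set.inter_subset_left ξ
      rw [hAB] at h
      simp only [measureReal_empty, mul_zero, Complex.ofReal_zero] at h
      refine (h.tsum_fiberwise
        (fun χ : Λ => (Quotient.mk (agreeSetoid K) χ.1 : Q))).congr_fun fun q => ?_
      have hpre : ((fun χ : Λ => (Quotient.mk (agreeSetoid K) χ.1 : Q)) ⁻¹' {q})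
          = (Fs q.out : Set Λ) := by
        ext χ
        simp only [Set.mem_preimage, Set.mem_singleton_iff, Finset.mem_coe, hFs]
        constructor
        · rintro rfl; exact (hmk χ.1).symm
        · intro hχ
          rw [← Quotient.out_eq q]
          exact Quotient.sound (s := agreeSetoid K) hχ
      rw [hpre, Finset.tsum_subtype' (Fs q.out) (fun χ : Λ =>
        charInt μ A (χ / ξ) * starRingEnd ℂ (charInt μ B (χ / ξ)))]
      simp only [s]
      rw [Finset.sum_mul]
      refine Finset.sum_congr rfl fun χ hχ => ?_
      have hag := ((hFs _ _).1 hχ).div ξ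
      rw [charInt_of_agreeOn hAm Set.inter_subset_right hag,
        charInt_of_agreeOn hBm Set.inter_subset_right hag]
      simp only [D, charVal_sub, charVal_div, map_mul, Complex.conj_conj]
      have e1 := charVal_mul_conj ξ a
      have e2 := charVal_mul_conj ξ b
      linear_combination -(charVal χ.1 a * starRingEnd ℂ (charVal χ.1 b) *
        starRingEnd ℂ (charVal q.out a) * charVal q.out b *
        charInt μ A (q.out / ξ) * starRingEnd ℂ (charInt μ B (q.out / ξ))) *
          ((charVal ξ b * starRingEnd ℂ (charVal ξ b)) * e1 + e2)
    have hA1 := charInt_of_agreeOn_one (μ := μ) hAm Set.inter_subset_right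
      (fun _ _ => rfl : AgreeOn K ξ ξ)
    have hB1 := charInt_of_agreeOn_one (μ := μ) hBm Set.inter_subset_right
      (fun _ _ => rfl : AgreeOn K ξ ξ)
    refine norm_le_of_hasSum_zero hsum q₀ hS (mul_pos ha0 hb0) ?_ fun F hF => ?_
    · rw [hnD]
      exact congrArg₂ _ hA1 hB1
    · have hpair : Pairwise fun i j : Q => ¬ AgreeOn K (i.out / ξ) (j.out / ξ) := by
        intro i j hij hag
        apply hij
        rw [← Quotient.out_eq i, ← Quotient.out_eq j]
        refine Quotient.sound (s := agreeSetoid K) fun w hw => ?_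
        have := hag w hw
        rw [charVal_div, charVal_div] at this
        exact mul_right_cancel₀ ((map_ne_zero _).2 (charVal_ne_zero ξ w)) this
      -- Including `q₀` in Bessel's inequality uses up `mA ^ 2` of `mK * mA`, so that only `mA * (mK
      -- - mA)` is left for the other classes; likewise for `B`.
      have hbA := sum_norm_charInt_sq_le hK hK0 hKfin a hAm Set.inter_subset_right _ hpair
        (insert q₀ F)
      have hbB := sum_norm_charInt_sq_le hK hK0 hKfin b hBm Set.inter_subset_right _ hpair
        (insert q₀ F)
      rw [Finset.sum_insert hF, hA1] at hbA
      rw [Finset.sum_insert hF, hB1] at hbB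
      simp only [hnD]
      refine abs_le_of_sq_le_sq' ?_ (by positivity) |>.2
      refine (Finset.sum_mul_sq_le_sq_mul_sq F _ _).trans ?_
      rw [mul_pow, hθ, Real.sq_sqrt (div_nonneg (mul_nonneg (by linarith) (by linarith))
        (by positivity))]
      have : (mK - mA) * (mK - mB) / (mA * mB) * (mA * mB) ^ 2
          = (mA * (mK - mA)) * (mB * (mK - mB)) := by
        field_simp
      rw [this]
      refine mul_le_mul (by linarith) (by linarith) (Finset.sum_nonneg fun _ _ => by positivity)
        (mul_nonneg ha0.le (by linarith))
  have hpow : ∀ n : ℕ, ∀ q, ‖s q‖ ≤ θ ^ n * M := by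
    intro n
    induction n with
    | zero => simpa using hM
    | succ n ih => intro q; rw [pow_succ', mul_assoc]; exact step _ ih q
  rw [← hsξ, ← norm_le_zero_iff]
  refine ge_of_tendsto' (f := fun n : ℕ => θ ^ n * M) (x := Filter.atTop) ?_ fun n => hpow n _
  simpa using (tendsto_pow_atTop_nhds_zero_of_lt_one hθ0 hθ1).mul_const M

end Vanishing

/-! ### Vanishing sums of roots of unity of prime power order. -/

section RootsOfUnity

open Polynomial

/-- In a vanishing sum of roots of unity of order dividing `p ^ (k + 1)`, the set of the terms is
stable under multiplication by `p`-th roots of unity. -/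
theorem exists_eq_mul_of_sum_eq_zero {p k : ℕ} (hp : p.Prime) {ι : Type*} {F : Finset ι}
    {w : ι → ℂ} (hw : ∀ i ∈ F, w i ^ p ^ (k + 1) = 1) (hsum : ∑ i ∈ F, w i = 0)
    {i₀ : ι} (hi₀ : i₀ ∈ F) {ω : ℂ} (hω : ω ^ p = 1) : ∃ i ∈ F, w i = w i₀ * ω := by
  classical
  have := Fact.mk hp
  set n := p ^ (k + 1) with hn
  have hn0 : 0 < n := pow_pos hp.pos _
  have hn0' : n ≠ 0 := hn0.ne'
  set q := p ^ k with hq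
  have hq0 : 0 < q := pow_pos hp.pos _
  have hnq : n = q * p := pow_succ p k
  obtain ⟨ζ, hζ⟩ : ∃ ζ : ℂ, IsPrimitiveRoot ζ n := ⟨_, Complex.isPrimitiveRoot_exp n hn0'⟩
  have : NeZero n := ⟨hn0'⟩
  have hw0 : w i₀ ≠ 0 := fun h => by
    have := hw i₀ hi₀; rw [h, zero_pow hn0'] at this; exact zero_ne_one this
  -- Dividing by `w i₀` gives `i₀` the exponent `0`, so the constant coefficient of `P` below is
  -- nonzero.
  have hex : ∀ i, ∃ e, i ∈ F → e < n ∧ ζ ^ e = w i / w i₀ := by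
    intro i
    by_cases hi : i ∈ F
    · obtain ⟨e, he, h⟩ := hζ.eq_pow_of_pow_eq_one (ξ := w i / w i₀)
        (by rw [div_pow, hw i hi, hw i₀ hi₀, div_one])
      exact ⟨e, fun _ => ⟨he, h⟩⟩
    · exact ⟨0, fun h => absurd h hi⟩
  choose e he using hex
  have he0 : e i₀ = 0 := by
    have h := (he i₀ hi₀).2
    rw [div_self hw0] at h
    exact Nat.eq_zero_of_dvd_of_lt ((hζ.pow_eq_one_iff_dvd _).1 h) (he i₀ hi₀).1
  set P : ℚ[X] := ∑ i ∈ F, X ^ e i with hP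
  have hPζ : aeval ζ P = 0 := by
    rw [hP, map_sum]
    simp only [map_pow, aeval_X]
    rw [Finset.sum_congr rfl fun i hi => (he i hi).2, ← Finset.sum_div, hsum, zero_div]
  have hdvd : cyclotomic n ℚ ∣ P := by
    rw [cyclotomic_eq_minpoly_rat hζ hn0]
    exact minpoly.dvd ℚ ζ hPζ
  obtain ⟨R, hR⟩ := hdvd
  have hcoeff : ∀ m, P.coeff m = ((F.filter fun i => e i = m).card : ℚ) := by
    intro m
    rw [hP, finsetSum_coeff]
    simp [coeff_X_pow, Finset.sum_boole, eq_comm]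
  have hP0 : P ≠ 0 := fun h => by
    have := hcoeff 0
    rw [h, coeff_zero, eq_comm, Nat.cast_eq_zero, Finset.card_eq_zero] at this
    exact Finset.notMem_empty i₀ (this ▸ Finset.mem_filter.2 ⟨hi₀, he0⟩)
  have hR0 : R ≠ 0 := fun h => hP0 (by rw [hR, h, mul_zero])
  have hdegP : P.natDegree < n := by
    refine lt_of_le_of_lt (natDegree_sum_le_of_forall_le F _ (n := n - 1) fun i hi => ?_) (by omega)
    rw [natDegree_X_pow]; have := (he i hi).1; omega
  have hdegR : R.natDegree < q := by
    rw [hR, natDegree_mul (cyclotomic_ne_zero n ℚ) hR0, natDegree_cyclotomic, hn,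
      Nat.totient_prime_pow_succ hp, ← hq, ← hn, hnq] at hdegP
    have : q * p = q * (p - 1) + q := by
      obtain ⟨r, rfl⟩ : ∃ r, p = r + 1 := ⟨p - 1, by have := hp.pos; omega⟩
      simp; ring
    omega
  -- `P = R * (1 + X ^ q + ⋯ + X ^ ((p - 1) * q))` with `deg R < q`: the shifted copies of `R` do
  -- not overlap.
  have hcoeffR : ∀ l < p, P.coeff (l * q) = R.coeff 0 := by
    intro l hl
    rw [hR, hn, cyclotomic_prime_pow_eq_geom_sum hp, Finset.sum_mul, finsetSum_coeff,
      Finset.sum_eq_single l]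
    · rw [← pow_mul, ← hq, mul_comm q l]
      simpa using coeff_X_pow_mul R (l * q) 0
    · intro j _ hj
      rw [← pow_mul, ← hq, coeff_X_pow_mul']
      split_ifs with hle
      · refine coeff_eq_zero_of_natDegree_lt (hdegR.trans_le ?_)
        rw [mul_comm q j] at hle ⊢
        have hjl : j < l := lt_of_le_of_ne (Nat.le_of_mul_le_mul_right hle hq0) hj
        obtain ⟨t, rfl⟩ := Nat.exists_eq_add_of_lt hjl
        rw [← Nat.sub_mul]
        have : j + t + 1 - j = t + 1 := by omega
        rw [this]
        nlinarith
      · rfl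
    · intro h; exact absurd (Finset.mem_range.2 hl) h
  have hζq : IsPrimitiveRoot (ζ ^ q) p := hζ.pow hn0 hnq
  have : NeZero p := ⟨hp.ne_zero⟩
  obtain ⟨l, hl, hlω⟩ := hζq.eq_pow_of_pow_eq_one hω
  have h1 : P.coeff (l * q) ≠ 0 := by
    rw [hcoeffR l hl, ← hcoeffR 0 hp.pos, hcoeff, Nat.cast_ne_zero, Finset.card_ne_zero]
    exact ⟨i₀, Finset.mem_filter.2 ⟨hi₀, by simpa using he0⟩⟩
  rw [hcoeff, Nat.cast_ne_zero, Finset.card_ne_zero] at h1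
  obtain ⟨i, hi⟩ := h1
  obtain ⟨hiF, hie⟩ := Finset.mem_filter.1 hi
  refine ⟨i, hiF, ?_⟩
  have h2 := (he i hiF).2
  rw [hie, mul_comm l q, pow_mul, hlω, eq_div_iff hw0] at h2
  rw [← h2, mul_comm]

end RootsOfUnity

/-! ### Balls, digits, Haar measure and density in `ℚ_p`. -/

section PadicBalls

variable (p : ℕ) [hp : Fact p.Prime]

/-- The compact open subgroup `p ^ j ℤ_p` of `ℚ_p`. -/
def padicBall (j : ℤ) : AddSubgroup ℚ_[p] where
  carrier := {x | ‖x‖ ≤ (p : ℝ) ^ (-j)}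
  zero_mem' := by
    simp only [Set.mem_ofPred_eq, norm_zero]
    exact zpow_nonneg (Nat.cast_nonneg p) _
  add_mem' {x y} hx hy := (Padic.nonarchimedean x y).trans (max_le hx hy)
  neg_mem' {x} hx := by simpa using hx

variable {p}

lemma mem_padicBall {j : ℤ} {x : ℚ_[p]} : x ∈ padicBall p j ↔ ‖x‖ ≤ (p : ℝ) ^ (-j) := Iff.rfl

lemma one_lt_cast_prime : (1 : ℝ) < p := by exact_mod_cast hp.out.one_lt

lemma padicBall_mono {i j : ℤ} (h : i ≤ j) : padicBall p j ≤ padicBall p i := fun _ hx =>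
  le_trans (mem_padicBall.1 hx) (zpow_le_zpow_right₀ one_lt_cast_prime.le (by omega))

lemma addCoset_padicBall (j : ℤ) (a : ℚ_[p]) :
    addCoset (padicBall p j) a = Metric.closedBall a ((p : ℝ) ^ (-j)) := by
  ext x
  rw [Metric.mem_closedBall, dist_eq_norm]
  rfl

lemma coe_padicBall (j : ℤ) :
    (padicBall p j : Set ℚ_[p]) = Metric.closedBall 0 ((p : ℝ) ^ (-j)) := by
  ext x
  rw [mem_closedBall_zero_iff]
  rfl

lemma padicBall_radius_pos (j : ℤ) : 0 < (p : ℝ) ^ (-j) :=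
  zpow_pos (by exact_mod_cast hp.out.pos) _

lemma isOpen_padicBall (j : ℤ) : IsOpen (padicBall p j : Set ℚ_[p]) := by
  rw [coe_padicBall]
  exact IsUltrametricDist.isOpen_closedBall _ (padicBall_radius_pos j).ne'

lemma norm_eq_of_mem_padicBall {j : ℤ} {u : ℚ_[p]} (hu : u ∈ padicBall p j)
    (hu' : u ∉ padicBall p (j + 1)) : ‖u‖ = (p : ℝ) ^ (-j) := by
  refine le_antisymm hu ?_
  rw [mem_padicBall, Padic.norm_le_pow_iff_norm_lt_pow_add_one, not_lt] at hu'
  convert hu' using 2; ring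

lemma exists_mem_padicBall_of_notMem {N : ℤ} {x : ℚ_[p]} (hx : x ∉ padicBall p N) :
    ∃ j < N, x ∈ padicBall p j ∧ x ∉ padicBall p (j + 1) := by
  have hx0 : x ≠ 0 := fun h => hx (h ▸ (padicBall p N).zero_mem)
  have hn := Padic.norm_eq_zpow_neg_valuation hx0
  have hlt : ∀ k, x ∈ padicBall p k ↔ k ≤ x.valuation := fun k => by
    rw [mem_padicBall, hn, zpow_le_zpow_iff_right₀ one_lt_cast_prime, neg_le_neg_iff]
  rw [hlt] at hx
  exact ⟨x.valuation, by omega, (hlt _).2 le_rfl, by rw [hlt]; omega⟩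

lemma exists_padicInt_coe_eq {x : ℚ_[p]} (hx : ‖x‖ ≤ 1) : ∃ z : ℤ_[p], (z : ℚ_[p]) = x :=
  ⟨⟨x, hx⟩, rfl⟩

/-- The multiples of an element of valuation `j` are dense in `p ^ j ℤ_p`. -/
lemma exists_nsmul_sub_mem_padicBall {j : ℤ} {u : ℚ_[p]} (hu : u ∈ padicBall p j)
    (hu' : u ∉ padicBall p (j + 1)) {x : ℚ_[p]} (hx : x ∈ padicBall p j) (N : ℤ) :
    ∃ n : ℕ, x - n • u ∈ padicBall p N := by
  have hnu := norm_eq_of_mem_padicBall hu hu'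
  have hnu0 : 0 < ‖u‖ := hnu ▸ padicBall_radius_pos j
  have hu0 : u ≠ 0 := norm_pos_iff.1 hnu0
  have hy : ‖x / u‖ ≤ 1 := by
    rw [norm_div, div_le_one hnu0, hnu]; exact hx
  obtain ⟨z, hz⟩ := exists_padicInt_coe_eq hy
  obtain ⟨n, hn⟩ := (PadicInt.denseRange_natCast (p := p)).exists_dist_lt z
    (ε := (p : ℝ) ^ (-(N - j))) (padicBall_radius_pos _)
  refine ⟨n, ?_⟩
  rw [dist_eq_norm, PadicInt.norm_def, PadicInt.coe_sub, hz, PadicInt.coe_natCast] at hn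
  have : x - n • u = (x / u - n) * u := by
    rw [nsmul_eq_mul]; field_simp
  rw [mem_padicBall, this, norm_mul, hnu]
  calc _ ≤ (p : ℝ) ^ (-(N - j)) * (p : ℝ) ^ (-j) := by
        gcongr
    _ = _ := by
        rw [← zpow_add₀ (by exact_mod_cast hp.out.ne_zero)]; congr 1; ring

lemma nsmul_pow_mem_padicBall {j : ℤ} {u : ℚ_[p]} (hu : u ∈ padicBall p j) (k : ℕ) :
    (p ^ k) • u ∈ padicBall p (j + k) := by
  rw [mem_padicBall, nsmul_eq_mul, norm_mul, Nat.cast_pow, norm_pow, Padic.norm_p, inv_pow,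
    ← zpow_natCast, ← zpow_neg, neg_add, zpow_add₀ (by exact_mod_cast hp.out.ne_zero), mul_comm]
  gcongr
  exact hu

lemma norm_mul_zpow_le_iff {i j : ℤ} {x : ℚ_[p]} :
    ‖x * (p : ℚ_[p]) ^ (-j)‖ ≤ (p : ℝ) ^ (-i) ↔ x ∈ padicBall p (i + j) := by
  rw [mem_padicBall, norm_mul, Padic.norm_p_zpow, neg_neg, neg_add,
    zpow_add₀ (by exact_mod_cast hp.out.ne_zero), zpow_neg _ j, ← div_eq_mul_inv,
    le_div_iff₀ (zpow_pos (by exact_mod_cast hp.out.pos) _)]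

lemma exists_padicInt_coe_eq_mul_zpow {j : ℤ} {x : ℚ_[p]} (hx : x ∈ padicBall p j) :
    ∃ z : ℤ_[p], (z : ℚ_[p]) = x * (p : ℚ_[p]) ^ (-j) := by
  refine exists_padicInt_coe_eq ?_
  have h := (norm_mul_zpow_le_iff (i := 0) (j := j)).2 ((zero_add j).symm ▸ hx)
  rwa [neg_zero, zpow_zero] at h

open Classical in
/-- The residue class modulo `p ^ (j + 1)` of an element of `p ^ j ℤ_p`. -/
noncomputable def leadingDigit (j : ℤ) (x : ℚ_[p]) : ZMod p :=
  -- The default `0` is taken only outside `p ^ j ℤ_p`.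
  if h : ∃ z : ℤ_[p], (z : ℚ_[p]) = x * (p : ℚ_[p]) ^ (-j) then PadicInt.toZMod h.choose else 0

lemma leadingDigit_eq {j : ℤ} {x : ℚ_[p]} {z : ℤ_[p]}
    (hz : (z : ℚ_[p]) = x * (p : ℚ_[p]) ^ (-j)) : leadingDigit j x = PadicInt.toZMod z := by
  have h : ∃ z : ℤ_[p], (z : ℚ_[p]) = x * (p : ℚ_[p]) ^ (-j) := ⟨z, hz⟩
  rw [leadingDigit, dif_pos h]
  congr 1
  exact PadicInt.ext (h.choose_spec.trans hz.symm)

lemma leadingDigit_eq_iff {j : ℤ} {x y : ℚ_[p]} (hx : x ∈ padicBall p j)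
    (hy : y ∈ padicBall p j) :
    leadingDigit j x = leadingDigit j y ↔ x - y ∈ padicBall p (j + 1) := by
  obtain ⟨z, hz⟩ := exists_padicInt_coe_eq_mul_zpow hx
  obtain ⟨w, hw⟩ := exists_padicInt_coe_eq_mul_zpow hy
  rw [leadingDigit_eq hz, leadingDigit_eq hw, ← sub_eq_zero, ← map_sub,
    ← RingHom.mem_ker, PadicInt.ker_toZMod, PadicInt.maximalIdeal_eq_span_p,
    ← pow_one (p : ℤ_[p]), ← PadicInt.norm_le_pow_iff_mem_span_pow, PadicInt.norm_def,
    PadicInt.coe_sub, hz, hw, ← sub_mul, add_comm j 1]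
  exact norm_mul_zpow_le_iff

/-- A digit function of level `j` on `ℚ_p`. -/
noncomputable def padicDigit (j : ℤ) (x : ℚ_[p]) : ZMod p :=
  -- A representative of the coset of `x` is subtracted, so digits are meaningful only for comparing
  -- points of the same coset of `p ^ j ℤ_p`.
  leadingDigit j (x - (QuotientAddGroup.mk x : ℚ_[p] ⧸ padicBall p j).out)

lemma padicDigit_eq_iff {j : ℤ} {x y : ℚ_[p]} (hxy : x - y ∈ padicBall p j) :
    padicDigit j x = padicDigit j y ↔ x - y ∈ padicBall p (j + 1) := by
  have hq : (QuotientAddGroup.mk x : ℚ_[p] ⧸ padicBall p j) = QuotientAddGroup.mk y := by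
    rw [eq_comm, QuotientAddGroup.eq]
    rwa [neg_add_eq_sub]
  have hr : ∀ z : ℚ_[p],
      z - (QuotientAddGroup.mk z : ℚ_[p] ⧸ padicBall p j).out ∈ padicBall p j := fun z => by
    rw [sub_eq_neg_add, ← QuotientAddGroup.eq]
    exact Quotient.out_eq' _
  rw [padicDigit, padicDigit, leadingDigit_eq_iff (hr x) (hr y), hq, sub_sub_sub_cancel_right]

variable [MeasurableSpace ℚ_[p]] {μ : Measure ℚ_[p]} [μ.IsAddHaarMeasure]

variable (μ) in
lemma measure_padicBall_ne_top (j : ℤ) : μ (padicBall p j : Set ℚ_[p]) ≠ ∞ := by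
  rw [coe_padicBall]
  exact (isCompact_closedBall _ _).measure_lt_top.ne

variable (μ) in
lemma measureReal_padicBall_pos (j : ℤ) : 0 < μ.real (padicBall p j : Set ℚ_[p]) :=
  ENNReal.toReal_pos
    ((isOpen_padicBall j).measure_pos μ ⟨0, (padicBall p j).zero_mem⟩).ne'
    (measure_padicBall_ne_top μ j)

variable [BorelSpace ℚ_[p]]

variable (μ) in
lemma measure_padicBall_succ (j : ℤ) :
    μ (padicBall p j : Set ℚ_[p]) = p * μ (padicBall p (j + 1) : Set ℚ_[p]) := by
  have hcoe : ∀ d : ZMod p, ((d.val : ℤ_[p]) : ℚ_[p])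
      = (d.val : ℚ_[p]) * (p : ℚ_[p]) ^ j * (p : ℚ_[p]) ^ (-j) := fun d => by
    rw [mul_assoc, ← zpow_add₀ (by exact_mod_cast hp.out.ne_zero), add_neg_cancel, zpow_zero,
      mul_one, PadicInt.coe_natCast]
  have hmem : ∀ d : ZMod p, (d.val : ℚ_[p]) * (p : ℚ_[p]) ^ j ∈ padicBall p j := fun d => by
    have h := (norm_mul_zpow_le_iff (i := 0) (j := j)
      (x := (d.val : ℚ_[p]) * (p : ℚ_[p]) ^ j)).1
    rw [zero_add, neg_zero, zpow_zero, ← hcoe] at h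
    exact h (PadicInt.norm_le_one _)
  have hdig : ∀ d : ZMod p, leadingDigit j ((d.val : ℚ_[p]) * (p : ℚ_[p]) ^ j) = d := fun d => by
    rw [leadingDigit_eq (hcoe d), map_natCast, ZMod.natCast_zmod_val]
  have hU : (padicBall p j : Set ℚ_[p])
      = ⋃ d : ZMod p, addCoset (padicBall p (j + 1)) ((d.val : ℚ_[p]) * (p : ℚ_[p]) ^ j) := by
    ext x
    simp only [SetLike.mem_coe, Set.mem_iUnion]
    constructor
    · intro hx
      refine ⟨leadingDigit j x, (leadingDigit_eq_iff hx (hmem _)).1 ?_⟩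
      rw [hdig]
    · rintro ⟨d, hd⟩
      have := (padicBall p j).add_mem (padicBall_mono (by omega) hd) (hmem d)
      simpa using this
  rw [hU, measure_iUnion]
  · simp [measure_addCoset, tsum_fintype, ZMod.card]
  · intro d e hde
    refine Set.disjoint_left.2 fun x hx hx' => hde ?_
    have h := (padicBall p (j + 1)).sub_mem hx' hx
    rw [← hdig d, ← hdig e, leadingDigit_eq_iff (hmem d) (hmem e)]
    simpa using h
  · exact fun d => measurableSet_addCoset (isOpen_padicBall _) _

instance isUnifLocDoublingMeasure_padic : IsUnifLocDoublingMeasure μ := by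
  -- If `p ^ n ≤ ε < p ^ (n + 1)`, then `2 * ε ≤ p ^ (n + 2)`: two levels of balls, each costing a
  -- factor `p`.
  refine ⟨(p : NNReal) ^ 2, ?_⟩
  filter_upwards [self_mem_nhdsWithin] with ε hε x
  obtain ⟨n, hn1, hn2⟩ := exists_mem_Ico_zpow (Set.mem_Ioi.1 hε) (one_lt_cast_prime (p := p))
  have h1 : addCoset (padicBall p (-n)) x ⊆ Metric.closedBall x ε := by
    rw [addCoset_padicBall, neg_neg]; exact Metric.closedBall_subset_closedBall hn1
  have h2 : Metric.closedBall x (2 * ε) ⊆ addCoset (padicBall p (-n - 2)) x := by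
    rw [addCoset_padicBall]
    refine Metric.closedBall_subset_closedBall ?_
    have h2p : (2 : ℝ) ≤ p := by exact_mod_cast hp.out.two_le
    calc 2 * ε ≤ p * (p : ℝ) ^ (n + 1) := by
          have h0 : 0 ≤ ε := (Set.mem_Ioi.1 hε).le
          have := hn2.le
          gcongr
      _ = _ := by
          rw [← zpow_one_add₀ (by exact_mod_cast hp.out.ne_zero)]; congr 1; ring
  calc _ ≤ μ (addCoset (padicBall p (-n - 2)) x) := measure_mono h2
    _ = (p : ℝ≥0∞) ^ 2 * μ (addCoset (padicBall p (-n)) x) := by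
      rw [measure_addCoset, measure_addCoset, measure_padicBall_succ, measure_padicBall_succ,
        ← mul_assoc, ← pow_two]
      congr 4; ring
    _ ≤ _ := by
      push_cast
      gcongr

/-- **Lebesgue density theorem** on `ℚ_p`, along the balls `x + p ^ n ℤ_p`. -/
lemma ae_tendsto_density (Ω : Set ℚ_[p]) : ∀ᵐ x ∂(μ.restrict Ω),
    Filter.Tendsto (fun n : ℕ => μ.real (Ω ∩ addCoset (padicBall p n) x) /
      μ.real (padicBall p n : Set ℚ_[p])) Filter.atTop (nhds 1) := by
  filter_upwards [IsUnifLocDoublingMeasure.ae_tendsto_measure_inter_div μ Ω 1] with x hx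
  have hlim : Filter.Tendsto (fun n : ℕ => (p : ℝ) ^ (-(n : ℤ))) Filter.atTop
      (nhdsWithin 0 (Set.Ioi 0)) := by
    refine tendsto_nhdsWithin_iff.2 ⟨?_, Filter.Eventually.of_forall fun n =>
      padicBall_radius_pos _⟩
    simp only [zpow_neg, zpow_natCast]
    exact tendsto_inv_atTop_zero.comp (tendsto_pow_atTop_atTop_of_one_lt one_lt_cast_prime)
  have h := hx (fun _ => x) _ hlim (Filter.Eventually.of_forall fun n =>
    Metric.mem_closedBall_self (by simp))
  have h' := (ENNReal.tendsto_toReal ENNReal.one_ne_top).comp h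
  refine h'.congr fun n => ?_
  simp only [Function.comp, ← addCoset_padicBall, measure_addCoset, ENNReal.toReal_div,
    measureReal_def]

end PadicBalls

/-! ### Branching of the spectrum. -/

section Branching

variable {p : ℕ} [hp : Fact p.Prime]

/-- Within each class modulo the annihilator of `p ^ (j + 1) ℤ_p` that it meets, `Λ` meets all
classes modulo the annihilator of `p ^ j ℤ_p`. -/
def BranchesAt (Λ : Set (PontryaginDual (Multiplicative ℚ_[p]))) (j : ℤ) : Prop :=
  ∃ u ∈ padicBall p j, ∀ χ ∈ Λ, ∀ ω : ℂ, ω ^ p = 1 →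
    ∃ ψ ∈ Λ, AgreeOn (padicBall p (j + 1)) ψ χ ∧ charVal ψ u = charVal χ u * ω

lemma BranchesAt.exists_finset {Λ : Set (PontryaginDual (Multiplicative ℚ_[p]))}
    {S : Finset ℤ} (hS : ∀ j ∈ S, BranchesAt Λ j) {N : ℤ} (hN : ∀ j ∈ S, j < N)
    {χ : PontryaginDual (Multiplicative ℚ_[p])} (hχ : χ ∈ Λ) :
    ∃ F : Finset Λ, (∀ ψ ∈ F, AgreeOn (padicBall p N) ψ.1 χ) ∧ p ^ S.card ≤ F.card := by
  classical
  induction S using Finset.induction_on_max generalizing N χ with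
  | empty => exact ⟨{⟨χ, hχ⟩}, by simp [AgreeOn], by simp⟩
  | insert m S hm ih =>
    -- Branching at the largest level `m` gives `p` characters with distinct values at `u`. The
    -- families produced below `m` agree with them on `p ^ m ℤ_p`, which contains `u`, hence are
    -- disjoint.
    obtain ⟨u, hu, hb⟩ := hS m (Finset.mem_insert_self _ _)
    obtain ⟨ζ, hζ⟩ : ∃ ζ : ℂ, IsPrimitiveRoot ζ p := ⟨_, Complex.isPrimitiveRoot_exp p hp.out.ne_zero⟩
    have hψ : ∀ t : ℕ, ∃ ψ ∈ Λ, AgreeOn (padicBall p (m + 1)) ψ χ ∧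
        charVal ψ u = charVal χ u * ζ ^ t := fun t =>
      hb χ hχ _ (by rw [← pow_mul, mul_comm, pow_mul, hζ.pow_eq_one, one_pow])
    choose ψ hψΛ hψa hψu using hψ
    have hF : ∀ t, ∃ F : Finset Λ, (∀ φ ∈ F, AgreeOn (padicBall p m) φ.1 (ψ t)) ∧
        p ^ S.card ≤ F.card := fun t =>
      ih (fun j hj => hS j (Finset.mem_insert_of_mem hj)) hm (hψΛ t)
    choose F hFa hFc using hF
    have hmN : m < N := hN m (Finset.mem_insert_self _ _)
    refine ⟨(Finset.range p).biUnion F, fun φ hφ => ?_, ?_⟩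
    · obtain ⟨t, -, ht⟩ := Finset.mem_biUnion.1 hφ
      exact ((hFa t φ ht).mono (padicBall_mono hmN.le)).trans
        ((hψa t).mono (padicBall_mono (by omega)))
    · rw [Finset.card_biUnion]
      · rw [Finset.card_insert_of_notMem fun h => lt_irrefl _ (hm m h), pow_succ']
        calc p * p ^ S.card = ∑ _t ∈ Finset.range p, p ^ S.card := by simp
          _ ≤ _ := Finset.sum_le_sum fun t _ => hFc t
      · intro s hs t ht hst
        refine Finset.disjoint_left.2 fun φ h1 h2 => hst ?_
        have h := (hFa s φ h1 u hu).symm.trans (hFa t φ h2 u hu)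
        rw [hψu, hψu] at h
        exact hζ.pow_inj (Finset.mem_range.1 hs) (Finset.mem_range.1 ht)
          (mul_left_cancel₀ (charVal_ne_zero χ u) h)

variable [MeasurableSpace ℚ_[p]] [BorelSpace ℚ_[p]] {μ : Measure ℚ_[p]} [μ.IsAddHaarMeasure]

/-- A spectrum branches at the valuation of a difference of two points around which `Ω` fills more
than half of a small ball. -/
lemma branchesAt_of_density {Ω : Set ℚ_[p]} (hΩ : MeasurableSet Ω) (hfin : μ Ω ≠ ∞)
    {Λ : Set (PontryaginDual (Multiplicative ℚ_[p]))} (hΛ : IsSpectralPair μ Ω Λ) {j : ℤ}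
    {k : ℕ} {x y : ℚ_[p]} (hxy : x - y ∈ padicBall p j) (hxy' : x - y ∉ padicBall p (j + 1))
    (hx : μ.real (padicBall p (j + (k + 1 : ℕ)) : Set ℚ_[p])
      < 2 * μ.real (Ω ∩ addCoset (padicBall p (j + (k + 1 : ℕ))) x))
    (hy : μ.real (padicBall p (j + (k + 1 : ℕ)) : Set ℚ_[p])
      < 2 * μ.real (Ω ∩ addCoset (padicBall p (j + (k + 1 : ℕ))) y)) :
    BranchesAt Λ j := by
  refine ⟨x - y, hxy, fun χ hχ ω hω => ?_⟩
  set u := x - y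
  set N : ℤ := j + (k + 1 : ℕ) with hN
  have hjN : j + 1 ≤ N := by omega
  obtain ⟨F, hF, hsum⟩ := exists_finset_sum_charVal_eq_zero hΩ hfin hΛ (isOpen_padicBall N)
    (measure_padicBall_ne_top μ N) (fun h => hxy' (padicBall_mono hjN h)) hx hy χ
  have huN : (p ^ (k + 1)) • u ∈ padicBall p N := nsmul_pow_mem_padicBall hxy (k + 1)
  -- Since `p ^ (k + 1) • u` lies in `p ^ N ℤ_p`, where `ψ` and `χ` agree, the ratios `ψ(u) / χ(u)`
  -- are roots of unity of order dividing `p ^ (k + 1)`.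
  obtain ⟨ψ, hψF, hψ⟩ := exists_eq_mul_of_sum_eq_zero hp.out (F := F) (k := k) (ω := ω)
    (w := fun ψ => charVal ψ.1 u * starRingEnd ℂ (charVal χ u)) (i₀ := ⟨χ, hχ⟩)
    (fun ψ hψ => by
      rw [mul_pow, ← map_pow, ← charVal_nsmul, ← charVal_nsmul, (hF ψ).1 hψ _ huN,
        charVal_mul_conj])
    (by rw [← Finset.sum_mul, hsum, zero_mul]) ((hF _).2 fun _ _ => rfl) hω
  have hψu : charVal ψ.1 u = charVal χ u * ω := by
    simp only [charVal_mul_conj, one_mul] at hψ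
    have h1 := charVal_mul_conj χ u
    linear_combination (charVal χ u) * hψ - (charVal ψ.1 u) * h1
  refine ⟨ψ, ψ.2, fun z hz => ?_, hψu⟩
  -- The factor `ω` disappears at `p • u`, whose multiples fill `p ^ (j + 1) ℤ_p` modulo `p ^ N
  -- ℤ_p`.
  have hpu : p • u ∈ padicBall p (j + 1) := by
    simpa using nsmul_pow_mem_padicBall hxy 1
  have hpu' : p • u ∉ padicBall p (j + 1 + 1) := by
    have h1 := norm_eq_of_mem_padicBall hxy hxy'
    rw [mem_padicBall, nsmul_eq_mul, norm_mul, h1, Padic.norm_p, ← zpow_neg_one,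
      ← zpow_add₀ (by exact_mod_cast hp.out.ne_zero), not_le]
    exact zpow_lt_zpow_right₀ one_lt_cast_prime (by omega)
  obtain ⟨n, hn⟩ := exists_nsmul_sub_mem_padicBall hpu hpu' hz N
  have hz' : z = n • (p • u) + (z - n • (p • u)) := by abel
  rw [hz', charVal_add, charVal_add, (hF ψ).1 hψF _ hn]
  simp only [charVal_nsmul]
  rw [hψu, mul_pow, hω, mul_one]

end Branching

/-! ### Tilings by unions of balls, and the limiting argument. -/

section Tiling

/-- Countability of `T` keeps the union of the translated exceptional null sets null. -/
lemma isTilingPair_of_ae_eq {G : Type*} [AddCommGroup G] [MeasurableSpace G] [MeasurableAdd G]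
    {μ : Measure G} [μ.IsAddRightInvariant] {Ω U T : Set G} (hT : T.Countable)
    (hΩU : Ω =ᵐ[μ] U) (hU : ∀ x, ∃! t, t ∈ T ∧ x - t ∈ U) : IsTilingPair μ Ω T := by
  have hcount : Countable T := hT.to_subtype
  have h : ∀ᵐ x ∂μ, ∀ t : T, x - (t : G) ∈ Ω ↔ x - (t : G) ∈ U := by
    rw [ae_all_iff]
    intro t
    have hmp : MeasurePreserving (fun x => x + -(t : G)) μ μ := measurePreserving_add_right μ _
    filter_upwards [hmp.quasiMeasurePreserving.ae hΩU] with x hx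
    rw [sub_eq_add_neg]
    exact iff_of_eq hx
  filter_upwards [h] with x hx
  obtain ⟨t₀, ⟨ht₀, hxt₀⟩, huniq⟩ := hU x
  rw [tsum_eq_single (⟨t₀, ht₀⟩ : T)]
  · exact Set.indicator_of_mem ((hx ⟨t₀, ht₀⟩).2 hxt₀) _
  · intro t ht
    refine Set.indicator_of_notMem (fun hmem => ht ?_) _
    exact Subtype.ext (huniq t ⟨t.2, (hx t).1 hmem⟩)

variable {p : ℕ} [hp : Fact p.Prime]

/-- At the level given by the valuation of `c i - c i'`, the two points share a coset but have
different digits. -/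
lemma padicDigit_injective {J : Finset ℤ} {ι : Type*} {c : ι → ℚ_[p]}
    (hc : Pairwise fun i i' => ∃ j ∈ J, c i - c i' ∈ padicBall p j ∧
      c i - c i' ∉ padicBall p (j + 1)) (x : ℚ_[p]) :
    Function.Injective fun (i : ι) (j : J) => padicDigit (j : ℤ) (x - c i) := by
  intro i i' h
  by_contra hne
  obtain ⟨j, hj, h1, h2⟩ := hc (Ne.symm hne)
  have h3 : x - c i - (x - c i') = c i' - c i := by abel
  exact h2 (h3 ▸ (padicDigit_eq_iff (h3.symm ▸ h1)).1 (congrFun h ⟨j, hj⟩))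

/-- A union of `p ^ #J` balls of radius `p ^ (-N)` such that the valuations of the differences of
their centers belong to `J` admits a tiling complement. -/
lemma exists_tiling_complement {J : Finset ℤ} {N : ℤ} (hJN : ∀ j ∈ J, j < N) {ι : Type*}
    [Fintype ι] {c : ι → ℚ_[p]}
    (hc : Pairwise fun i i' => ∃ j ∈ J, c i - c i' ∈ padicBall p j ∧
      c i - c i' ∉ padicBall p (j + 1)) (hcard : Fintype.card ι = p ^ J.card) :
    ∃ T : Set ℚ_[p], T.Countable ∧
      ∀ x, ∃! t, t ∈ T ∧ x - t ∈ ⋃ i, addCoset (padicBall p N) (c i) := by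
  have hbij : ∀ x, Function.Bijective fun (i : ι) (j : J) => padicDigit (j : ℤ) (x - c i) :=
    fun x => (Fintype.bijective_iff_injective_and_card _).2
      ⟨padicDigit_injective hc x, by simp [hcard, ZMod.card]⟩
  let out : ℚ_[p] → ℚ_[p] := fun x => (QuotientAddGroup.mk x : ℚ_[p] ⧸ padicBall p N).out
  have hout : ∀ x, x - out x ∈ padicBall p N := fun x => by
    rw [sub_eq_neg_add, ← QuotientAddGroup.eq]
    exact Quotient.out_eq' _
  have hdig : ∀ {j : ℤ}, j ∈ J → ∀ {x y : ℚ_[p]}, x - y ∈ padicBall p N →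
      padicDigit j x = padicDigit j y := fun {j} hj {x y} hxy =>
    (padicDigit_eq_iff (padicBall_mono (hJN j hj).le hxy)).2
      (padicBall_mono (by have := hJN j hj; omega) hxy)
  -- If `x - t` lies in the ball of `c i`, then `t` represents the coset of `x - c i`. By `hbij`,
  -- exactly one `i` makes all the digits of `x - c i` at levels in `J` zero.
  let T : Set ℚ_[p] := {t | out t = t ∧ ∀ j ∈ J, padicDigit j t = 0}
  refine ⟨T, ?_, fun x => ?_⟩
  · have : DiscreteTopology (ℚ_[p] ⧸ padicBall p N) :=
      QuotientAddGroup.discreteTopology (isOpen_padicBall N)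
    have : Countable (ℚ_[p] ⧸ padicBall p N) :=
      TopologicalSpace.separableSpace_iff_countable.1 inferInstance
    refine (Set.countable_range
      fun q : ℚ_[p] ⧸ padicBall p N => (q.out : ℚ_[p])).mono fun t ht => ?_
    exact ⟨QuotientAddGroup.mk t, ht.1⟩
  · obtain ⟨i, hi⟩ := (hbij x).2 0
    have hxi := hout (x - c i)
    have hmk : out (out (x - c i)) = out (x - c i) := by
      exact congrArg Quotient.out (Quotient.out_eq' _)
    refine ⟨out (x - c i), ⟨⟨hmk, fun j hj => ?_⟩, ?_⟩, ?_⟩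
    · rw [← hdig hj hxi]; exact congrFun hi ⟨j, hj⟩
    · refine Set.mem_iUnion.2 ⟨i, ?_⟩
      simp only [addCoset, Set.mem_ofPred_eq]
      rwa [sub_right_comm]
    · rintro t ⟨⟨ht1, ht2⟩, ht3⟩
      obtain ⟨i', hi'⟩ := Set.mem_iUnion.1 ht3
      have hi'' : x - c i' - t ∈ padicBall p N := by
        rw [sub_right_comm]; exact hi'
      have hii : i' = i := (hbij x).1 <| by
        rw [hi]
        funext j
        exact (hdig j.2 hi'').trans (ht2 j j.2)
      subst hii
      rw [← ht1]
      simp only [out]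
      congr 1
      rw [eq_comm, QuotientAddGroup.eq, neg_add_eq_sub, ← neg_sub]
      exact (padicBall p N).neg_mem hi''

/-- A sequence which is bounded below by `m`, is asymptotically at most `m`, and is divided by
either `1` or `p ≥ 2` at each step takes the value `m`. -/
lemma exists_eq_of_discrete_steps {b r : ℕ → ℝ} {m P : ℝ} (hm : 0 < m) (hP : 2 ≤ P)
    (hb : ∀ n, m ≤ b n) (hbr : ∀ n, b n * r n ≤ m)
    (hr : Filter.Tendsto r Filter.atTop (nhds 1))
    (hstep : ∀ n, b (n + 1) = b n ∨ P * b (n + 1) = b n) : ∃ n, b n = m := by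
  -- Once `r n > 1 / 2`, `b n < 2 * m`, and a further division by `P ≥ 2` would fall below `m`.
  obtain ⟨n₀, hn₀⟩ := Filter.eventually_atTop.1 (hr.eventually_const_lt (one_half_lt_one (α := ℝ)))
  have hlt : ∀ n ≥ n₀, b n < 2 * m := fun n hn => by
    have h1 := hn₀ n hn
    have h2 := hbr n
    have h3 := hb n
    nlinarith
  have hconst : ∀ n ≥ n₀, b n = b n₀ := by
    intro n hn
    induction n, hn using Nat.le_induction with
    | base => rfl
    | succ n hn ih =>
      rcases hstep n with h | h
      · rw [h, ih]
      · have h1 := hlt n hn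
        have h2 := hb (n + 1)
        nlinarith
  refine ⟨n₀, le_antisymm ?_ (hb n₀)⟩
  have hlim : Filter.Tendsto (fun n => b n₀ * r n) Filter.atTop (nhds (b n₀)) := by
    simpa using hr.const_mul (b n₀)
  refine le_of_tendsto hlim ?_
  filter_upwards [Filter.eventually_ge_atTop n₀] with n hn
  rw [← hconst n hn]
  exact hbr n

end Tiling

/-! ### From the valuations of differences to a tiling. -/

section Structure

variable {p : ℕ} [hp : Fact p.Prime]

/-- The valuations of the nonzero differences of elements of `D`. -/
def differenceValuations (D : Set ℚ_[p]) : Set ℤ :=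
  {j | ∃ x ∈ D, ∃ y ∈ D, x - y ∈ padicBall p j ∧ x - y ∉ padicBall p (j + 1)}

/-- A choice of centers, in `D`, of the balls of radius `p ^ (-N)` that meet `D`. -/
lemma exists_centers (D : Set ℚ_[p]) (N : ℤ) {J : Finset ℤ}
    (hJ : ∀ j, j ∈ J ↔ j ∈ differenceValuations D ∧ j < N) :
    ∃ (ι : Type) (_ : Fintype ι) (c : ι → ℚ_[p]),
      (Pairwise fun i i' => ∃ j ∈ J, c i - c i' ∈ padicBall p j ∧
        c i - c i' ∉ padicBall p (j + 1)) ∧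
      (D ⊆ ⋃ i, addCoset (padicBall p N) (c i)) ∧ Fintype.card ι ≤ p ^ J.card := by
  let ι := ((QuotientAddGroup.mk : ℚ_[p] → ℚ_[p] ⧸ padicBall p N) '' D)
  have hι : ∀ q : ι, ∃ x ∈ D, (QuotientAddGroup.mk x : ℚ_[p] ⧸ padicBall p N) = q := fun q => q.2
  choose c hcD hcq using hι
  have hpair : Pairwise fun i i' => ∃ j ∈ J, c i - c i' ∈ padicBall p j ∧
      c i - c i' ∉ padicBall p (j + 1) := by
    intro i i' hii
    have hnot : c i - c i' ∉ padicBall p N := fun h => hii <| Subtype.ext <| by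
      rw [← hcq i, ← hcq i', eq_comm, QuotientAddGroup.eq, neg_add_eq_sub]
      exact h
    obtain ⟨j, hjN, h1, h2⟩ := exists_mem_padicBall_of_notMem hnot
    exact ⟨j, (hJ j).2 ⟨⟨c i, hcD i, c i', hcD i', h1, h2⟩, hjN⟩, h1, h2⟩
  have hinj := padicDigit_injective hpair 0
  have hfin : Finite ι := Finite.of_injective _ hinj
  let _ : Fintype ι := Fintype.ofFinite ι
  refine ⟨ι, inferInstance, c, hpair, fun x hx => ?_, ?_⟩
  · refine Set.mem_iUnion.2 ⟨⟨QuotientAddGroup.mk x, x, hx, rfl⟩, ?_⟩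
    have h := hcq ⟨QuotientAddGroup.mk x, x, hx, rfl⟩
    rw [QuotientAddGroup.eq, neg_add_eq_sub] at h
    exact h
  · have := Fintype.card_le_of_injective _ hinj
    simpa [ZMod.card] using this

variable [MeasurableSpace ℚ_[p]] [BorelSpace ℚ_[p]] {μ : Measure ℚ_[p]} [μ.IsAddHaarMeasure]

lemma measure_iUnion_addCoset_le {ι : Type*} [Fintype ι] (c : ι → ℚ_[p]) (N : ℤ) :
    μ (⋃ i, addCoset (padicBall p N) (c i)) ≤
      Fintype.card ι * μ (padicBall p N : Set ℚ_[p]) := by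
  refine (measure_iUnion_fintype_le _ _).trans ?_
  simp [measure_addCoset]

/-- If almost all points of `Ω` lie in `D` and the measure of `Ω` is the largest one allowed by the
valuations of the differences of elements of `D`, then `Ω` is a tile. -/
lemma isTile_of_measure_eq {Ω D : Set ℚ_[p]} (hΩ : MeasurableSet Ω) (hfin : μ Ω ≠ ∞)
    (hD : ∀ᵐ x ∂(μ.restrict Ω), x ∈ D) {N : ℤ} {J : Finset ℤ}
    (hJ : ∀ j, j ∈ J ↔ j ∈ differenceValuations D ∧ j < N)
    (hm : (p ^ J.card : ℕ) * μ.real (padicBall p N : Set ℚ_[p]) = μ.real Ω) : IsTile μ Ω := by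
  obtain ⟨ι, _, c, hc, hcov, hle⟩ := exists_centers D N hJ
  set U := ⋃ i, addCoset (padicBall p N) (c i) with hU
  have hΩU : Ω ≤ᵐ[μ] U := by
    filter_upwards [(ae_restrict_iff' hΩ).1 hD] with x hx hxΩ
    exact hcov (hx hxΩ)
  have hKfin := measure_padicBall_ne_top μ N
  have hUle : μ U ≤ Fintype.card ι * μ (padicBall p N : Set ℚ_[p]) :=
    measure_iUnion_addCoset_le c N
  have hUfin : μ U ≠ ∞ := ne_top_of_le_ne_top (ENNReal.mul_ne_top (by simp) hKfin) hUle
  have hUle' : μ.real U ≤ Fintype.card ι * μ.real (padicBall p N : Set ℚ_[p]) := by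
    have := ENNReal.toReal_mono (ENNReal.mul_ne_top (by simp) hKfin) hUle
    simpa [measureReal_def] using this
  have hΩU' : μ.real Ω ≤ μ.real U := ENNReal.toReal_mono hUfin (measure_mono_ae hΩU)
  have hK0 := measureReal_padicBall_pos μ N
  have hle' : (Fintype.card ι : ℝ) ≤ (p ^ J.card : ℕ) := by exact_mod_cast hle
  -- The measure of `Ω` leaves no room for fewer balls, so every digit pattern occurs.
  have hcard : Fintype.card ι = p ^ J.card := by
    refine le_antisymm hle ?_
    have h : ((p ^ J.card : ℕ) : ℝ) ≤ Fintype.card ι :=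
      le_of_mul_le_mul_right (by linarith) hK0
    exact_mod_cast h
  obtain ⟨T, hT, htile⟩ := exists_tiling_complement (fun j hj => ((hJ j).1 hj).2) hc hcard
  have hUm : μ.real U ≤ μ.real Ω := by rw [← hm, ← hcard]; exact hUle'
  have hμU : μ U ≤ μ Ω := (ENNReal.toReal_le_toReal hUfin hfin).1 hUm
  exact ⟨T, isTilingPair_of_ae_eq hT
    (ae_eq_of_ae_subset_of_measure_ge hΩU hμU hΩ.nullMeasurableSet hUfin) htile⟩

/-- If the multiplicity of each finite set of valuations of differences of points of density is
controlled by the measure of `Ω`, then `Ω` is a tile. -/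
lemma isTile_of_forall_card_le {Ω D : Set ℚ_[p]} (hΩ : MeasurableSet Ω) (hpos : μ Ω ≠ 0)
    (hfin : μ Ω ≠ ∞) (hD : ∀ᵐ x ∂(μ.restrict Ω), x ∈ D) {x₀ : ℚ_[p]}
    (hx₀ : Filter.Tendsto (fun n : ℕ => μ.real (Ω ∩ addCoset (padicBall p n) x₀) /
      μ.real (padicBall p n : Set ℚ_[p])) Filter.atTop (nhds 1))
    (hS : ∀ (n : ℕ) (S : Finset ℤ), (∀ j ∈ S, j ∈ differenceValuations D ∧ j < n) →
      (p ^ S.card : ℕ) * μ.real (Ω ∩ addCoset (padicBall p n) x₀) ≤ μ.real Ω) :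
    IsTile μ Ω := by
  classical
  have hm : 0 < μ.real Ω := ENNReal.toReal_pos hpos hfin
  -- Density at `x₀` gives positive measure in some finer ball, hence in the ball of level `n`.
  have hposn : ∀ n : ℕ, 0 < μ.real (Ω ∩ addCoset (padicBall p n) x₀) := by
    intro n
    obtain ⟨k, hk, hnk⟩ := ((hx₀.eventually_const_lt (zero_lt_one (α := ℝ))).and
      (Filter.eventually_ge_atTop n)).exists
    refine ((div_pos_iff_of_pos_right (measureReal_padicBall_pos μ k)).1 hk).trans_le ?_
    refine measureReal_mono (Set.inter_subset_inter_right _ fun x hx => ?_)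
      (measure_ne_top_of_subset Set.inter_subset_left hfin)
    exact padicBall_mono (by exact_mod_cast hnk) hx
  -- Infinitely many valuations below `n` would make `p ^ S.card` unbounded against a fixed positive
  -- measure.
  have hJfin : ∀ n : ℕ, {j : ℤ | j ∈ differenceValuations D ∧ j < n}.Finite := by
    intro n
    by_contra hinf
    obtain ⟨k, hk⟩ := exists_nat_gt (μ.real Ω / μ.real (Ω ∩ addCoset (padicBall p n) x₀))
    obtain ⟨S, hSJ, hSk⟩ := Set.Infinite.exists_subset_card_eq hinf k
    have h := hS n S fun j hj => hSJ hj
    rw [hSk, ← le_div_iff₀ (hposn n)] at h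
    have h' : (k : ℝ) < (p ^ k : ℕ) := by exact_mod_cast Nat.lt_pow_self hp.out.one_lt
    linarith
  let J : ℕ → Finset ℤ := fun n => (hJfin n).toFinset
  have hJ : ∀ (n : ℕ) (j : ℤ), j ∈ J n ↔ j ∈ differenceValuations D ∧ j < n := fun n j => by
    simp [J]
  have hsucc : ∀ n : ℕ, μ.real (padicBall p n : Set ℚ_[p])
      = p * μ.real (padicBall p (n + 1 : ℕ) : Set ℚ_[p]) := fun n => by
    rw [measureReal_def, measure_padicBall_succ, ENNReal.toReal_mul, measureReal_def]
    simp
  suffices h : ∃ n : ℕ, (p ^ (J n).card : ℕ) * μ.real (padicBall p n : Set ℚ_[p])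
      = μ.real Ω by
    obtain ⟨n, hn⟩ := h
    exact isTile_of_measure_eq hΩ hfin hD (hJ n) hn
  refine exists_eq_of_discrete_steps
    (b := fun n : ℕ => (p ^ (J n).card : ℕ) * μ.real (padicBall p n : Set ℚ_[p]))
    (P := p) hm (by exact_mod_cast hp.out.two_le) (fun n => ?_) (fun n => ?_) hx₀ (fun n => ?_)
  · obtain ⟨ι, _, c, -, hcov, hle⟩ := exists_centers D n (hJ n)
    have h1 : μ Ω ≤ Fintype.card ι * μ (padicBall p n : Set ℚ_[p]) := by
      refine (measure_mono_ae ?_).trans (measure_iUnion_addCoset_le c n)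
      filter_upwards [(ae_restrict_iff' hΩ).1 hD] with x hx hxΩ
      exact hcov (hx hxΩ)
    have h2 := ENNReal.toReal_mono
      (ENNReal.mul_ne_top (by simp) (measure_padicBall_ne_top μ n)) h1
    rw [ENNReal.toReal_mul, ENNReal.toReal_natCast] at h2
    refine h2.trans ?_
    have : (Fintype.card ι : ℝ) ≤ (p ^ (J n).card : ℕ) := by exact_mod_cast hle
    exact mul_le_mul_of_nonneg_right this ENNReal.toReal_nonneg
  · have h := hS n (J n) fun j hj => (hJ n j).1 hj
    have hK := measureReal_padicBall_pos μ n
    rw [mul_assoc, mul_div_cancel₀ _ hK.ne']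
    exact h
  -- A new valuation `n` contributes a factor `p`, cancelling the shrinking of the ball; otherwise
  -- the product is divided by `p`.
  · by_cases hnJ : (n : ℤ) ∈ differenceValuations D
    · left
      have : J (n + 1) = insert (n : ℤ) (J n) := by
        ext j
        rw [Finset.mem_insert, hJ, hJ]
        push_cast
        constructor
        · rintro ⟨h1, h2⟩
          rcases (Int.lt_add_one_iff.1 h2).eq_or_lt with h | h
          exacts [Or.inl h, Or.inr ⟨h1, h⟩]
        · rintro (rfl | ⟨h1, h2⟩)
          exacts [⟨hnJ, by omega⟩, ⟨h1, by omega⟩]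
      rw [this, Finset.card_insert_of_notMem (by rw [hJ]; simp), hsucc n, pow_succ]
      push_cast
      ring
    · right
      have : J (n + 1) = J n := by
        ext j
        rw [hJ, hJ]
        push_cast
        refine ⟨fun ⟨h1, h2⟩ => ⟨h1, ?_⟩, fun ⟨h1, h2⟩ => ⟨h1, by omega⟩⟩
        refine (Int.lt_add_one_iff.1 h2).lt_of_ne ?_
        rintro rfl
        exact hnJ h1
      rw [this, hsucc n]
      ring

end Structure

theorem theorem5p1 (p : ℕ) [Fact p.Prime] [MeasurableSpace ℚ_[p]] [BorelSpace ℚ_[p]]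
    (μ : Measure ℚ_[p]) [μ.IsAddHaarMeasure]
    (Ω : Set ℚ_[p]) (hΩ : MeasurableSet Ω) (hpos : 0 < μ Ω) (hfin : μ Ω < ∞)
    (hspec : IsSpectralSet μ Ω) :
    IsTile μ Ω := by
  obtain ⟨Λ, hΛ⟩ := hspec
  have hm : 0 < μ.real Ω := ENNReal.toReal_pos hpos.ne' hfin.ne
  obtain ⟨χ, hχ⟩ : Λ.Nonempty := by
    by_contra hempty
    have : IsEmpty Λ := Set.isEmpty_coe_sort.2 (Set.not_nonempty_iff_eq_empty.1 hempty)
    have h := (hasSum_charInt_mul_conj hpos.ne' hfin.ne hΛ hΩ hΩ subset_rfl subset_rfl 1).unique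
      hasSum_empty
    rw [Set.inter_self, Complex.ofReal_eq_zero] at h
    exact (mul_pos hm hm).ne' h
  let D : Set ℚ_[p] := {x | Filter.Tendsto (fun n : ℕ =>
    μ.real (Ω ∩ addCoset (padicBall p n) x) / μ.real (padicBall p n : Set ℚ_[p]))
      Filter.atTop (nhds 1)}
  have hD : ∀ᵐ x ∂(μ.restrict Ω), x ∈ D := ae_tendsto_density Ω
  obtain ⟨x₀, hx₀⟩ : ∃ x₀, x₀ ∈ D := by
    have : (ae (μ.restrict Ω)).NeBot := ae_neBot.2 (by
      rw [Ne, Measure.restrict_eq_zero]; exact hpos.ne')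
    exact hD.exists
  have hbranch : ∀ j ∈ differenceValuations D, BranchesAt Λ j := by
    rintro j ⟨x, hx, y, hy, hxy, hxy'⟩
    have hhalf : ∀ z ∈ D, ∀ᶠ n : ℕ in Filter.atTop,
        μ.real (padicBall p n : Set ℚ_[p]) < 2 * μ.real (Ω ∩ addCoset (padicBall p n) z) := by
      intro z hz
      filter_upwards [Filter.Tendsto.eventually_const_lt (one_half_lt_one (α := ℝ)) hz] with n hn
      rw [lt_div_iff₀ (measureReal_padicBall_pos μ n)] at hn
      linarith
    -- The condition `n ≥ j + 1` makes the balls around `x` and `y` disjoint and lets `n` be written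
    -- as `j + (k + 1)`.
    obtain ⟨n, ⟨h1, h2⟩, hn⟩ := (((hhalf x hx).and (hhalf y hy)).and
      (Filter.eventually_ge_atTop (j + 1).toNat)).exists
    obtain ⟨k, hk⟩ : ∃ k : ℕ, (n : ℤ) = j + (k + 1 : ℕ) := ⟨(n - j - 1).toNat, by omega⟩
    rw [hk] at h1 h2
    exact branchesAt_of_density hΩ hfin.ne hΛ hxy hxy' h1 h2
  refine isTile_of_forall_card_le hΩ hpos.ne' hfin.ne hD hx₀ fun n S hS => ?_
  obtain ⟨F, hF, hcard⟩ := BranchesAt.exists_finset (fun j hj => hbranch j (hS j hj).1)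
    (fun j hj => (hS j hj).2) hχ
  have h := card_mul_measureReal_le hΩ hpos.ne' hfin.ne hΛ
    (measurableSet_addCoset (isOpen_padicBall (p := p) n) x₀) χ F hF
  refine le_trans ?_ h
  exact mul_le_mul_of_nonneg_right (by exact_mod_cast hcard) measureReal_nonneg
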